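/- A \emph{map} is a finite connected graph (loops and multiple edges allowed) embedded in the sphere, with a marked oriented edge (the root), considered up to orientation-preserving homeomorphism; equivalently, a finite connected rooted rotation system (a set of oriented edges with the reversal and the clockwise cyclic orders around the vertices) of Euler characteristic $2$, up to isomorphism. The degree of a face is the number of oriented edges having it on their left; a $q$-angulation is a map all of whose faces have degree $q$; an $m$-edge tree is a map with a single face and $m$ edges. An $m$-tree-decorated map is a pair $(\mathfrak m,\mathfrak t)$ of a map and a submap $\mathfrak t$ (a set of edges with their endpoints and the induced cyclic orders) that contains the root edge and, rooted there, is an $m$-edge tree. A $q$-angulation with a simple boundary of size $2m$ is a map whose root face (the face on the left of the root, called external) has degree $2m$ and is bounded by a simple closed curve, and all of whose other (internal) faces have degree $q$. The ungluing map $\phi$ sends $(\mathfrak m,\mathfrak t)$ to $(\mathfrak t,\mathfrak m^b)$, where $\mathfrak m^b$ is obtained by cutting the sphere open along $\mathfrak t$: each edge of $\mathfrak t$ is doubled, each vertex of $\mathfrak t$ is replaced by its corners, and the root of $\mathfrak m^b$ is the copy of the root edge, with the same direction, that has the newly created face on its left. \textbf{Proposition.} For all $q,m\in\mathbb N$, the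 ungluing map $\phi$ restricts to a bijection from the set of $m$-tree-decorated $q$-angulations onto the set of pairs $(\mathfrak t,\mathfrak m^b)$ formed by an $m$-edge tree $\mathfrak t$ and a $q$-angulation $\mathfrak m^b$ with a simple boundary of size $2m$. Moreover, for every $m$-tree-decorated map $(\mathfrak m,\mathfrak t)$ with image $(\mathfrak t,\mathfrak m^b)$, there is a degree-preserving bijection between the faces of $\mathfrak m$ and the internal faces of $\mathfrak m^b$. -/

import Mathlib

open Equiv

/-- A finite graph drawn on an oriented surface, with a marked oriented edge, in the usual
combinatorial encoding: `Dart` is the set of oriented edges, `rev` reverses an oriented edge, and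
`rot d` is the oriented edge that follows `d` in the clockwise order around the starting point of
`d`. Loops and multiple edges are allowed. Neither connectedness nor planarity is required yet. -/
structure RootedRotationSystem where
  Dart : Type
  [finite : Finite Dart]
  rot : Perm Dart
  rev : Perm Dart
  rev_rev : ∀ d, rev (rev d) = d
  rev_ne : ∀ d, rev d ≠ d
  root : Dart

namespace RootedRotationSystem

attribute [instance] RootedRotationSystem.finite

variable (M : RootedRotationSystem)

/-- The vertices are the cycles of the rotation. -/
def Vertex : Type := Quotient (Perm.SameCycle.setoid M.rot)

/-- The (unoriented) edges are the cycles of the reversal. -/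
def Edge : Type := Quotient (Perm.SameCycle.setoid M.rev)

/-- Walking along `d` with a face on the left, the next oriented edge of that face is the first one
met after `rev d` in clockwise order around the endpoint of `d`. -/
def faceStep : Perm M.Dart := M.rev.trans M.rot

/-- The faces are the cycles of the face walk. -/
def Face : Type := Quotient (Perm.SameCycle.setoid M.faceStep)

/-- The starting point of an oriented edge. -/
def source (d : M.Dart) : M.Vertex := Quotient.mk (Perm.SameCycle.setoid M.rot) d

/-- The face on the left of an oriented edge. -/
def leftFace (d : M.Dart) : M.Face := Quotient.mk (Perm.SameCycle.setoid M.faceStep) d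

/-- The degree of a face: the number of oriented edges that have it on their left. -/
noncomputable def faceDegree (F : M.Face) : ℕ := Nat.card {d : M.Dart // M.leftFace d = F}

/-- The root face: the face on the left of the root edge. -/
def rootFace : M.Face := M.leftFace M.root

/-- Any oriented edge can be reached from any other by rotations and reversals. -/
def IsConnected : Prop :=
  ∀ d d' : M.Dart, ∃ g ∈ Subgroup.closure ({M.rot, M.rev} : Set (Perm M.Dart)), g d = d'

/-- A rooted planar map: the graph is connected and the surface is the sphere, i.e. the Euler
characteristic is `2`. -/
def IsPlanarMap : Prop :=
  M.IsConnected ∧ Nat.card M.Vertex + Nat.card M.Face = Nat.card M.Edge + 2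

/-- A planted plane tree with `m` edges: a map with a single face and `m` edges. -/
def IsPlaneTree (m : ℕ) : Prop :=
  M.IsPlanarMap ∧ Nat.card M.Face = 1 ∧ Nat.card M.Edge = m

/-- A `q`-angulation: a map all of whose faces have degree `q`. -/
def IsAngulation (q : ℕ) : Prop :=
  M.IsPlanarMap ∧ ∀ F : M.Face, M.faceDegree F = q

/-- The internal faces of a map with a boundary, whose external face is the root face. -/
def InternalFace : Type := {F : M.Face // F ≠ M.rootFace}

/-- A map with a simple boundary of size `n`: the root face has degree `n`, and its boundary walk is
a simple closed curve, i.e. it visits no vertex twice and traverses no edge in both directions (the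
latter only excludes the map with a single edge joining two vertices). -/
def HasSimpleBoundary (n : ℕ) : Prop :=
  M.IsPlanarMap ∧ M.faceDegree M.rootFace = n ∧
    (∀ d d' : M.Dart, M.leftFace d = M.rootFace → M.leftFace d' = M.rootFace →
      M.source d = M.source d' → d = d') ∧
    (∀ d : M.Dart, M.leftFace d = M.rootFace → M.leftFace (M.rev d) ≠ M.rootFace)

/-- A `q`-angulation with a simple boundary of size `n`: all internal faces have degree `q`. -/
def IsAngulationWithSimpleBoundary (q n : ℕ) : Prop :=
  M.HasSimpleBoundary n ∧ ∀ F : M.InternalFace, M.faceDegree F.1 = q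

/-- Isomorphism: a relabelling of the oriented edges that preserves the clockwise order around the
vertices, the reversal and the root. -/
def Iso (M N : RootedRotationSystem) : Prop :=
  ∃ e : M.Dart ≃ N.Dart, (∀ d, e (M.rot d) = N.rot (e d)) ∧ (∀ d, e (M.rev d) = N.rev (e d)) ∧
    e M.root = N.root

theorem iso_equivalence : Equivalence Iso where
  refl _ := ⟨Equiv.refl _, fun _ => rfl, fun _ => rfl, rfl⟩
  symm := by
    rintro M N ⟨e, h1, h2, h3⟩
    refine ⟨e.symm, fun d => ?_, fun d => ?_, ?_⟩
    · rw [Equiv.symm_apply_eq, h1, Equiv.apply_symm_apply]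
    · rw [Equiv.symm_apply_eq, h2, Equiv.apply_symm_apply]
    · rw [Equiv.symm_apply_eq, h3]
  trans := by
    rintro M N P ⟨e, h1, h2, h3⟩ ⟨e', h1', h2', h3'⟩
    exact ⟨e.trans e', fun d => by simp [h1, h1'], fun d => by simp [h2, h2'], by simp [h3, h3']⟩

instance isoSetoid : Setoid RootedRotationSystem := ⟨Iso, iso_equivalence⟩

end RootedRotationSystem

/-- Rooted maps are considered up to isomorphism. -/
def RootedMapClass : Type 1 := Quotient RootedRotationSystem.isoSetoid

/-- The isomorphism class of a rooted rotation system. -/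
def RootedRotationSystem.toClass (M : RootedRotationSystem) : RootedMapClass :=
  Quotient.mk RootedRotationSystem.isoSetoid M

/-- The set of planted plane trees with `m` edges, up to isomorphism. -/
def planeTrees (m : ℕ) : Set RootedMapClass :=
  {c | ∃ M : RootedRotationSystem, M.IsPlaneTree m ∧ M.toClass = c}

/-- The set of `q`-angulations with a simple boundary of size `n`, up to isomorphism. -/
def angulationsWithSimpleBoundary (q n : ℕ) : Set RootedMapClass :=
  {c | ∃ M : RootedRotationSystem, M.IsAngulationWithSimpleBoundary q n ∧ M.toClass = c}

section InducedPerm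

variable {D : Type} [Finite D] (σ : Perm D) (T : Set D)

theorem exists_pow_succ_mem (x : T) : ∃ n : ℕ, (σ ^ (n + 1)) (x : D) ∈ T := by
  refine ⟨orderOf σ - 1, ?_⟩
  have h : orderOf σ - 1 + 1 = orderOf σ := Nat.sub_add_cancel (orderOf_pos σ)
  rw [h, pow_orderOf_eq_one]
  exact x.2

open Classical in
/-- The first of `σ x`, `σ (σ x)`, … that lies in `T`. -/
noncomputable def firstReturn (x : T) : T :=
  ⟨(σ ^ (Nat.find (exists_pow_succ_mem σ T x) + 1)) (x : D),
    Nat.find_spec (exists_pow_succ_mem σ T x)⟩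

theorem firstReturn_spec (x : T) : ∃ n : ℕ, (firstReturn σ T x : D) = (σ ^ (n + 1)) (x : D) ∧
    ∀ k < n, (σ ^ (k + 1)) (x : D) ∉ T := by
  classical
  exact ⟨Nat.find (exists_pow_succ_mem σ T x), rfl,
    fun k hk => Nat.find_min (exists_pow_succ_mem σ T x) hk⟩

theorem firstReturn_eq (x y : T) (n : ℕ) (h : (y : D) = (σ ^ (n + 1)) (x : D))
    (hn : ∀ k < n, (σ ^ (k + 1)) (x : D) ∉ T) : firstReturn σ T x = y := by
  obtain ⟨p, hp, hp'⟩ := firstReturn_spec σ T x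
  have : p = n := by
    rcases lt_trichotomy p n with hlt | heq | hlt
    · exact absurd (hp ▸ (firstReturn σ T x).2) (hn p hlt)
    · exact heq
    · exact absurd (h ▸ y.2) (hp' n hlt)
  subst this
  exact Subtype.ext (hp.trans h.symm)

theorem firstReturn_injective : Function.Injective (firstReturn σ T) := by
  intro x y hxy
  obtain ⟨p, hp, hp'⟩ := firstReturn_spec σ T x
  obtain ⟨r, hr, hr'⟩ := firstReturn_spec σ T y
  have key : (σ ^ (p + 1)) (x : D) = (σ ^ (r + 1)) (y : D) := by rw [← hp, ← hr, hxy]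
  rcases lt_trichotomy p r with hlt | heq | hlt
  · obtain ⟨k, rfl⟩ := Nat.exists_eq_add_of_lt hlt
    have h1 : (σ ^ (p + 1)) (x : D) = (σ ^ (p + 1)) ((σ ^ (k + 1)) (y : D)) := by
      rw [key, ← Perm.mul_apply, ← pow_add]; congr 2; omega
    exact absurd ((σ ^ (p + 1)).injective h1 ▸ x.2) (hr' k (by omega))
  · subst heq
    exact Subtype.ext ((σ ^ (p + 1)).injective key)
  · obtain ⟨k, rfl⟩ := Nat.exists_eq_add_of_lt hlt
    have h1 : (σ ^ (r + 1)) ((σ ^ (k + 1)) (x : D)) = (σ ^ (r + 1)) (y : D) := by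
      rw [← key, ← Perm.mul_apply, ← pow_add]; congr 2; omega
    exact absurd ((σ ^ (r + 1)).injective h1 ▸ y.2) (hp' k (by omega))

/-- The cyclic orders that `σ` induces on `T`. -/
noncomputable def inducedPerm : Perm T :=
  Equiv.ofBijective (firstReturn σ T)
    (Finite.injective_iff_bijective.mp (firstReturn_injective σ T))

theorem inducedPerm_apply (x : T) : inducedPerm σ T x = firstReturn σ T x := rfl

end InducedPerm

/-- A rooted rotation system with a distinguished set of edges, given by the set `deco` of their
orientations, among which is the root edge. -/
structure DecoratedRotationSystem extends RootedRotationSystem where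
  deco : Set Dart
  rev_mem : ∀ d ∈ deco, rev d ∈ deco
  root_mem : root ∈ deco

namespace DecoratedRotationSystem

variable (X : DecoratedRotationSystem)

theorem rev_mem_iff (d : X.Dart) : X.rev d ∈ X.deco ↔ d ∈ X.deco :=
  ⟨fun h => by simpa [X.rev_rev] using X.rev_mem _ h, X.rev_mem d⟩

/-- The reversal on the decorating edges. -/
def decoRev : Perm X.deco where
  toFun d := ⟨X.rev d.1, X.rev_mem _ d.2⟩
  invFun d := ⟨X.rev d.1, X.rev_mem _ d.2⟩
  left_inv d := Subtype.ext (X.rev_rev d.1)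
  right_inv d := Subtype.ext (X.rev_rev d.1)

/-- The submap formed by the decorating edges and their endpoints: all other edges and vertices are
suppressed, the cyclic orders around the remaining vertices are the induced ones, and the root is
the same. -/
noncomputable def submap : RootedRotationSystem where
  Dart := X.deco
  rot := inducedPerm X.rot X.deco
  rev := X.decoRev
  rev_rev d := Subtype.ext (X.rev_rev d.1)
  rev_ne d h := X.rev_ne d.1 (congrArg Subtype.val h)
  root := ⟨X.root, X.root_mem⟩

/-- A tree-decorated map whose tree has `m` edges and contains the root edge. -/
def IsTreeDecoratedMap (m : ℕ) : Prop :=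
  X.toRootedRotationSystem.IsPlanarMap ∧ X.submap.IsPlaneTree m

/-- An `m`-tree-decorated `q`-angulation. -/
def IsTreeDecoratedAngulation (q m : ℕ) : Prop :=
  X.toRootedRotationSystem.IsAngulation q ∧ X.submap.IsPlaneTree m

/-- Isomorphism of decorated maps: an isomorphism of rooted maps that matches the decorations. -/
def Iso (X Y : DecoratedRotationSystem) : Prop :=
  ∃ e : X.Dart ≃ Y.Dart, (∀ d, e (X.rot d) = Y.rot (e d)) ∧ (∀ d, e (X.rev d) = Y.rev (e d)) ∧
    e X.root = Y.root ∧ ∀ d, d ∈ X.deco ↔ e d ∈ Y.deco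

theorem iso_equivalence : Equivalence Iso where
  refl _ := ⟨Equiv.refl _, fun _ => rfl, fun _ => rfl, rfl, fun _ => Iff.rfl⟩
  symm := by
    rintro M N ⟨e, h1, h2, h3, h4⟩
    refine ⟨e.symm, fun d => ?_, fun d => ?_, ?_, fun d => ?_⟩
    · rw [Equiv.symm_apply_eq, h1, Equiv.apply_symm_apply]
    · rw [Equiv.symm_apply_eq, h2, Equiv.apply_symm_apply]
    · rw [Equiv.symm_apply_eq, h3]
    · rw [h4, Equiv.apply_symm_apply]
  trans := by
    rintro M N P ⟨e, h1, h2, h3, h4⟩ ⟨e', h1', h2', h3', h4'⟩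
    exact ⟨e.trans e', fun d => by simp [h1, h1'], fun d => by simp [h2, h2'], by simp [h3, h3'],
      fun d => by simp [h4, h4']⟩

instance isoSetoid : Setoid DecoratedRotationSystem := ⟨Iso, iso_equivalence⟩

/-! ### Ungluing

The surface is cut open along the decorating edges. The oriented edges of the result are
`inl d` for each oriented edge `d` of the map, which keeps the face on the left of `d`, and
`inr a` for each orientation `a` of a decorating edge, a new oriented edge, parallel to `a`, which
lies on the right side of `a` and has the newly created hole on its left. -/

open Classical in
/-- The reversal after ungluing. The copy of a decorating edge on the left side of `a` consists of
`inl a` and `inr (rev a)`. -/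
noncomputable def unglueRevFun : X.Dart ⊕ X.deco → X.Dart ⊕ X.deco
  | Sum.inl d => if h : d ∈ X.deco then Sum.inr (X.decoRev ⟨d, h⟩) else Sum.inl (X.rev d)
  | Sum.inr a => Sum.inl (X.rev a.1)

theorem unglueRevFun_unglueRevFun (x : X.Dart ⊕ X.deco) :
    X.unglueRevFun (X.unglueRevFun x) = x := by
  rcases x with d | a
  · by_cases h : d ∈ X.deco
    · simp [unglueRevFun, h, decoRev, X.rev_rev]
    · simp [unglueRevFun, h, X.rev_mem_iff, X.rev_rev]
  · simp [unglueRevFun, X.rev_mem_iff, X.rev_rev, decoRev]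

theorem unglueRevFun_ne (x : X.Dart ⊕ X.deco) : X.unglueRevFun x ≠ x := by
  rcases x with d | a
  · by_cases h : d ∈ X.deco
    · simp [unglueRevFun, h]
    · simp [unglueRevFun, h, X.rev_ne]
  · simp [unglueRevFun]

open Classical in
/-- The clockwise rotation after ungluing. A vertex of the decoration is replaced by its corners. If
`a` and `b` are consecutive decorating edges in clockwise order around a vertex, then the oriented
edges that start at the corner between them are, in clockwise order, `inr a`, then `inl d` for the
oriented edges `d` strictly between `a` and `b`, then `inl b`. -/
noncomputable def unglueRotFun : X.Dart ⊕ X.deco → X.Dart ⊕ X.deco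
  | Sum.inl d =>
      if h : d ∈ X.deco then Sum.inr ((inducedPerm X.rot X.deco).symm ⟨d, h⟩)
      else Sum.inl (X.rot d)
  | Sum.inr a => Sum.inl (X.rot a.1)

open Classical in
/-- The counterclockwise rotation after ungluing. -/
noncomputable def unglueRotInv : X.Dart ⊕ X.deco → X.Dart ⊕ X.deco
  | Sum.inl d =>
      if h : X.rot.symm d ∈ X.deco then Sum.inr ⟨X.rot.symm d, h⟩ else Sum.inl (X.rot.symm d)
  | Sum.inr a => Sum.inl (inducedPerm X.rot X.deco a).1

/-- The map obtained by ungluing. Its root is the copy of the root edge, with the same direction,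
that has the hole on its left. -/
noncomputable def unglued : RootedRotationSystem where
  Dart := X.Dart ⊕ X.deco
  rot :=
    { toFun := X.unglueRotFun
      invFun := X.unglueRotInv
      left_inv := by
        rintro (d | a)
        · by_cases h : d ∈ X.deco <;> simp [unglueRotFun, unglueRotInv, h]
        · simp [unglueRotFun, unglueRotInv]
      right_inv := by
        rintro (d | a)
        · by_cases h : X.rot.symm d ∈ X.deco <;> simp [unglueRotFun, unglueRotInv, h]
        · simp [unglueRotFun, unglueRotInv] }
  rev :=
    { toFun := X.unglueRevFun
      invFun := X.unglueRevFun
      left_inv := X.unglueRevFun_unglueRevFun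
      right_inv := X.unglueRevFun_unglueRevFun }
  rev_rev := X.unglueRevFun_unglueRevFun
  rev_ne := X.unglueRevFun_ne
  root := Sum.inr ⟨X.root, X.root_mem⟩

variable {X} {Y : DecoratedRotationSystem}

theorem inducedPerm_map (e : X.Dart ≃ Y.Dart) (h1 : ∀ d, e (X.rot d) = Y.rot (e d))
    (h4 : ∀ d, d ∈ X.deco ↔ e d ∈ Y.deco) (a : X.deco) :
    e.subtypeEquiv h4 (inducedPerm X.rot X.deco a) =
      inducedPerm Y.rot Y.deco (e.subtypeEquiv h4 a) := by
  have hpow : ∀ (n : ℕ) (d : X.Dart), e ((X.rot ^ n) d) = (Y.rot ^ n) (e d) := by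
    intro n
    induction n with
    | zero => intro d; rfl
    | succ n ih => intro d; rw [pow_succ, pow_succ, Perm.mul_apply, Perm.mul_apply, ih, h1]
  obtain ⟨n, hn, hn'⟩ := firstReturn_spec X.rot X.deco a
  symm
  refine firstReturn_eq Y.rot Y.deco _ _ n ?_ ?_
  · simp only [Equiv.subtypeEquiv_apply, inducedPerm_apply]
    rw [hn, hpow]
  · intro k hk
    simp only [Equiv.subtypeEquiv_apply]
    rw [← hpow, ← h4]
    exact hn' k hk

theorem submap_iso (h : Iso X Y) : X.submap.Iso Y.submap := by
  obtain ⟨e, h1, h2, h3, h4⟩ := h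
  exact ⟨e.subtypeEquiv h4, inducedPerm_map e h1 h4, fun d => Subtype.ext (h2 d.1),
    Subtype.ext h3⟩

theorem unglued_iso (h : Iso X Y) : X.unglued.Iso Y.unglued := by
  obtain ⟨e, h1, h2, h3, h4⟩ := h
  have h5 : ∀ a : X.deco, e.subtypeEquiv h4 ((inducedPerm X.rot X.deco).symm a) =
      (inducedPerm Y.rot Y.deco).symm (e.subtypeEquiv h4 a) := by
    intro a
    rw [Equiv.eq_symm_apply, ← inducedPerm_map e h1 h4, Equiv.apply_symm_apply]
  refine ⟨Equiv.sumCongr e (e.subtypeEquiv h4), ?_, ?_, ?_⟩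
  · rintro (d | a)
    · change Equiv.sumCongr e (e.subtypeEquiv h4) (X.unglueRotFun (Sum.inl d)) =
        Y.unglueRotFun (Sum.inl (e d))
      by_cases h : d ∈ X.deco
      · have h' : e d ∈ Y.deco := (h4 d).1 h
        simp only [unglueRotFun, h, h', dif_pos]
        exact congrArg Sum.inr (h5 ⟨d, h⟩)
      · have h' : e d ∉ Y.deco := fun hc => h ((h4 d).2 hc)
        simp only [unglueRotFun, h, h', dif_neg, not_false_iff]
        exact congrArg Sum.inl (h1 d)
    · exact congrArg Sum.inl (h1 a.1)
  · rintro (d | a)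
    · change Equiv.sumCongr e (e.subtypeEquiv h4) (X.unglueRevFun (Sum.inl d)) =
        Y.unglueRevFun (Sum.inl (e d))
      by_cases h : d ∈ X.deco
      · have h' : e d ∈ Y.deco := (h4 d).1 h
        simp only [unglueRevFun, h, h', dif_pos]
        exact congrArg Sum.inr (Subtype.ext (h2 d))
      · have h' : e d ∉ Y.deco := fun hc => h ((h4 d).2 hc)
        simp only [unglueRevFun, h, h', dif_neg, not_false_iff]
        exact congrArg Sum.inl (h2 d)
    · exact congrArg Sum.inl (h2 a.1)
  · exact congrArg Sum.inr (Subtype.ext h3)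

end DecoratedRotationSystem

/-- Decorated rooted maps are considered up to isomorphism. -/
def DecoratedMapClass : Type 1 := Quotient DecoratedRotationSystem.isoSetoid

/-- The isomorphism class of a decorated rooted rotation system. -/
def DecoratedRotationSystem.toClass (X : DecoratedRotationSystem) : DecoratedMapClass :=
  Quotient.mk DecoratedRotationSystem.isoSetoid X

/-- The set of `m`-tree-decorated `q`-angulations with the root edge on the tree, up to
isomorphism. -/
def treeDecoratedAngulations (q m : ℕ) : Set DecoratedMapClass :=
  {c | ∃ X : DecoratedRotationSystem, X.IsTreeDecoratedAngulation q m ∧ X.toClass = c}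

/-- The ungluing map: a decorated map is sent to the pair formed by its decoration, as a rooted map
of its own, and the map with a boundary obtained by cutting along the decoration. -/
noncomputable def ungluing : DecoratedMapClass → RootedMapClass × RootedMapClass :=
  Quotient.lift (fun X : DecoratedRotationSystem => (X.submap.toClass, X.unglued.toClass))
    (fun _ _ h => Prod.ext (Quotient.sound (DecoratedRotationSystem.submap_iso h))
      (Quotient.sound (DecoratedRotationSystem.unglued_iso h)))

/-! Since reversal is an involution, `rot` is `rev` followed by `faceStep`, so a rotation system is
determined by its reversal and its face walk. This suits cutting and gluing: both keep the face walk
of every internal face and alter only the reversal along the tree.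

In the unglued map the face walk is the original one on old oriented edges and `holeStep` on new
ones (`unglued_faceStep_old`, `unglued_faceStep_new`). Conjugation by `rev` turns `holeStep` into
the inverse of the face walk of the decoration; as a tree has one face, it is a single cycle of
length 2m. So the faces of the map become the internal faces with their degrees, and the hole is one
face of degree 2m. Each vertex carries at most one new oriented edge, which makes the boundary
simple. With V, E, F the counts in the map, cutting gives V - (m + 1) + 2m vertices, E + m edges and
F + 1 faces, so the Euler characteristic is unchanged and planarity passes in both directions.

Injectivity (`iso_of_unglued_iso`): isomorphisms of the trees and of the unglued maps agree on the
new oriented edges, because both preserve the root and the walk around the hole. The second one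
therefore preserves the old oriented edges, and there it descends to an isomorphism of decorated
maps.

Surjectivity (`BoundaryLabelling`): two cycles of length 2m are conjugate with matched roots, so the
boundary can be labelled by the oriented edges of the tree. Delete the boundary, keep the face walk,
and reverse the sides facing the boundary as the tree prescribes. Simplicity of the boundary then
shows that the rotation induced on these sides is that of the tree (`sideEquiv_rot`). -/

section SameCycle

/-! ### Cycles of permutations of finite sets -/

variable {A B : Type*} {f : Perm A} {f' : Perm B}

theorem sameCycle_induction [Finite A] {P : A → Prop} (hP : ∀ a, P a → P (f a)) {a b : A}
    (h : f.SameCycle a b) (ha : P a) : P b := by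
  obtain ⟨n, rfl⟩ := h.exists_nat_pow_eq
  clear h
  induction n with
  | zero => exact ha
  | succ n ih => rw [pow_succ', Perm.mul_apply]; exact hP _ ih

/-- Only cycles have to be respected, not successors: gluing back may send neighbours around a
corner to non-neighbours around the same vertex. -/
theorem sameCycle_map [Finite A] {g : A → B} (hg : ∀ a, f'.SameCycle (g a) (g (f a))) {a b : A}
    (h : f.SameCycle a b) : f'.SameCycle (g a) (g b) :=
  sameCycle_induction (P := fun c => f'.SameCycle (g a) (g c)) (fun c hc => hc.trans (hg c)) h
    (Perm.SameCycle.refl _ _)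

theorem pow_semiconj {g : A → B} (hg : ∀ a, f' (g a) = g (f a)) (n : ℕ) (a : A) :
    (f' ^ n) (g a) = g ((f ^ n) a) := by
  induction n with
  | zero => rfl
  | succ n ih => rw [pow_succ', pow_succ', Perm.mul_apply, Perm.mul_apply, ih, hg]

theorem sameCycle_iff_of_semiconj [Finite A] [Finite B] {g : A → B} (hinj : Function.Injective g)
    (hg : ∀ a, f' (g a) = g (f a)) {a b : A} :
    f'.SameCycle (g a) (g b) ↔ f.SameCycle a b := by
  refine ⟨fun h => ?_, sameCycle_map fun a => ?_⟩
  · obtain ⟨n, hn⟩ := h.exists_nat_pow_eq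
    rw [pow_semiconj hg] at hn
    exact ⟨n, by simpa using hinj hn⟩
  · rw [← hg]
    exact (Perm.SameCycle.refl _ _).apply_right

theorem pow_eq_pow_iff_of_transitive [Finite A] (hf : ∀ a b : A, f.SameCycle a b) (a : A)
    (n k : ℕ) : (f ^ n) a = (f ^ k) a ↔ n ≡ k [MOD Nat.card A] := by
  have := Fintype.ofFinite A
  have hc : f.IsCycleOn (Finset.univ : Finset A) :=
    ⟨by simp [Set.bijOn_univ], fun a _ b _ => hf a b⟩
  rw [hc.pow_apply_eq_pow_apply (Finset.mem_univ a), Finset.card_univ, Nat.card_eq_fintype_card]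

/-- Two cyclic permutations of sets of the same size are conjugate, with prescribed base points. -/
theorem exists_equiv_of_transitive [Finite A] [Finite B] (hf : ∀ a b : A, f.SameCycle a b)
    (hf' : ∀ a b : B, f'.SameCycle a b) (hcard : Nat.card A = Nat.card B) (a₀ : A) (b₀ : B) :
    ∃ h : A ≃ B, h a₀ = b₀ ∧ ∀ a, h (f a) = f' (h a) := by
  choose n hn using fun a => (hf a₀ a).exists_nat_pow_eq
  -- The chosen exponents matter only modulo the common period, so any exponent reaching `a` gives
  -- the same image.
  have key : ∀ a k, (f ^ k) a₀ = a → (f' ^ (n a)) b₀ = (f' ^ k) b₀ := by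
    intro a k hk
    rw [pow_eq_pow_iff_of_transitive hf', ← hcard, ← pow_eq_pow_iff_of_transitive hf a₀, hn, hk]
  have hinj : Function.Injective fun a => (f' ^ (n a)) b₀ := by
    intro a b hab
    have hab' : (f' ^ (n a)) b₀ = (f' ^ (n b)) b₀ := hab
    rw [pow_eq_pow_iff_of_transitive hf', ← hcard, ← pow_eq_pow_iff_of_transitive hf a₀, hn, hn]
      at hab'
    exact hab'
  refine ⟨Equiv.ofBijective _ ((Nat.bijective_iff_injective_and_card _).2 ⟨hinj, hcard⟩), ?_, ?_⟩
  · exact key a₀ 0 rfl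
  · intro a
    change (f' ^ (n (f a))) b₀ = f' ((f' ^ (n a)) b₀)
    rw [key (f a) (n a + 1) (by rw [pow_succ', Perm.mul_apply, hn]), pow_succ', Perm.mul_apply]

/-- Conjugate permutations have equivalent sets of cycles. -/
def sameCycleQuotientCongr [Finite A] [Finite B] (e : A ≃ B) (he : ∀ a, e (f a) = f' (e a)) :
    Quotient (Perm.SameCycle.setoid f) ≃ Quotient (Perm.SameCycle.setoid f') :=
  Quotient.congr e fun _ _ => (sameCycle_iff_of_semiconj e.injective fun a => (he a).symm).symm

end SameCycle

/-! ### Counts, connectedness and isomorphisms of rotation systems -/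

namespace RootedRotationSystem

variable {M N : RootedRotationSystem}

instance : Finite M.Vertex := inferInstanceAs (Finite (Quotient _))
instance : Finite M.Edge := inferInstanceAs (Finite (Quotient _))
instance : Finite M.Face := inferInstanceAs (Finite (Quotient _))

theorem leftFace_eq_iff {d d' : M.Dart} :
    M.leftFace d = M.leftFace d' ↔ M.faceStep.SameCycle d d' := Quotient.eq

theorem source_eq_iff {d d' : M.Dart} : M.source d = M.source d' ↔ M.rot.SameCycle d d' :=
  Quotient.eq

theorem leftFace_surjective : Function.Surjective M.leftFace := Quotient.mk_surjective

theorem source_surjective : Function.Surjective M.source := Quotient.mk_surjective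

theorem faceStep_apply (d : M.Dart) : M.faceStep d = M.rot (M.rev d) := rfl

theorem faceStep_rev (d : M.Dart) : M.faceStep (M.rev d) = M.rot d := by
  rw [faceStep_apply, M.rev_rev]

theorem leftFace_faceStep (d : M.Dart) : M.leftFace (M.faceStep d) = M.leftFace d :=
  leftFace_eq_iff.2 (Perm.SameCycle.refl _ _).apply_left

variable (M) in
/-- The edge carrying an oriented edge. -/
def edge (d : M.Dart) : M.Edge := Quotient.mk (Perm.SameCycle.setoid M.rev) d

theorem edge_eq_iff {d d' : M.Dart} : M.edge d' = M.edge d ↔ d' = d ∨ d' = M.rev d := by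
  refine Quotient.eq.trans ⟨fun h => ?_, ?_⟩
  · refine sameCycle_induction (f := M.rev) (P := fun x => x = d ∨ x = M.rev d) ?_
      (Perm.SameCycle.symm h) (Or.inl rfl)
    rintro x (rfl | rfl)
    · exact Or.inr rfl
    · exact Or.inl (M.rev_rev _)
  · rintro (rfl | rfl)
    · exact Perm.SameCycle.refl _ _
    · exact (Perm.SameCycle.refl _ _).apply_left

theorem card_dart : Nat.card M.Dart = 2 * Nat.card M.Edge := by
  have hfib : ∀ E : M.Edge, Nat.card {d : M.Dart // M.edge d = E} = 2 := by
    intro E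
    obtain ⟨d, rfl⟩ : ∃ d, M.edge d = E := Quotient.exists_rep E
    simp only [edge_eq_iff]
    change Nat.card ↥({d, M.rev d} : Set M.Dart) = 2
    rw [Nat.card_coe_set_eq, Set.ncard_pair (M.rev_ne d).symm]
  have := Fintype.ofFinite M.Edge
  rw [← Nat.card_congr (Equiv.sigmaFiberEquiv M.edge), Nat.card_sigma]
  simp [hfib, mul_comm]

theorem faceDegree_leftFace (d : M.Dart) :
    M.faceDegree (M.leftFace d) = Nat.card {d' : M.Dart // M.faceStep.SameCycle d' d} :=
  Nat.card_congr (Equiv.subtypeEquivRight fun _ => leftFace_eq_iff)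

/-! ### Connectedness -/

variable (M) in
/-- The second oriented edge can be reached from the first one by rotations and reversals. -/
def Linked (d d' : M.Dart) : Prop :=
  ∃ g ∈ Subgroup.closure ({M.rot, M.rev} : Set (Perm M.Dart)), g d = d'

theorem Linked.refl (d : M.Dart) : M.Linked d d := ⟨1, one_mem _, rfl⟩

theorem Linked.symm {d d' : M.Dart} : M.Linked d d' → M.Linked d' d := by
  rintro ⟨g, hg, rfl⟩
  exact ⟨g⁻¹, inv_mem hg, by simp⟩

theorem Linked.trans {d d' d'' : M.Dart} : M.Linked d d' → M.Linked d' d'' → M.Linked d d'' := by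
  rintro ⟨g, hg, rfl⟩ ⟨g', hg', rfl⟩
  exact ⟨g' * g, mul_mem hg' hg, rfl⟩

theorem linked_rot (d : M.Dart) : M.Linked d (M.rot d) :=
  ⟨M.rot, Subgroup.subset_closure (by simp), rfl⟩

theorem linked_rev (d : M.Dart) : M.Linked d (M.rev d) :=
  ⟨M.rev, Subgroup.subset_closure (by simp), rfl⟩

theorem linked_faceStep (d : M.Dart) : M.Linked d (M.faceStep d) :=
  (linked_rev d).trans (linked_rot _)

theorem linked_of_sameCycle_rot {d d' : M.Dart} (h : M.rot.SameCycle d d') : M.Linked d d' :=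
  sameCycle_induction (P := M.Linked d) (fun _ hc => hc.trans (linked_rot _)) h (Linked.refl _)

theorem linked_of_sameCycle_faceStep {d d' : M.Dart} (h : M.faceStep.SameCycle d d') :
    M.Linked d d' :=
  sameCycle_induction (P := M.Linked d) (fun _ hc => hc.trans (linked_faceStep _)) h
    (Linked.refl _)

theorem Linked.map {p : M.Dart → N.Dart} (hrot : ∀ d, N.Linked (p d) (p (M.rot d)))
    (hrev : ∀ d, N.Linked (p d) (p (M.rev d))) {d d' : M.Dart} (h : M.Linked d d') :
    N.Linked (p d) (p d') := by
  obtain ⟨g, hg, rfl⟩ := h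
  revert d
  induction hg using Subgroup.closure_induction with
  | mem g hg =>
    rcases hg with rfl | rfl
    · exact fun {d} => hrot d
    · exact fun {d} => hrev d
  | one => exact Linked.refl _
  | mul g g' _ _ ih ih' => exact ih'.trans ih
  | inv g _ ih =>
    intro d
    have := ih (d := g⁻¹ d)
    rw [show g (g⁻¹ d) = d from g.apply_symm_apply d] at this
    exact this.symm

theorem IsConnected.map {p : M.Dart → N.Dart} (hM : M.IsConnected) (hp : Function.Surjective p)
    (hrot : ∀ d, N.Linked (p d) (p (M.rot d))) (hrev : ∀ d, N.Linked (p d) (p (M.rev d))) :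
    N.IsConnected := by
  intro d d'
  obtain ⟨x, rfl⟩ := hp d
  obtain ⟨x', rfl⟩ := hp d'
  exact Linked.map hrot hrev (hM x x')

/-! ### Isomorphisms -/

/-- Rotation is the face walk after a reversal, so isomorphisms can be checked on face walks, which
ungluing barely changes. -/
theorem rot_eq_of_faceStep_eq {e : M.Dart → N.Dart} (hrev : ∀ d, e (M.rev d) = N.rev (e d))
    (hface : ∀ d, e (M.faceStep d) = N.faceStep (e d)) (d : M.Dart) :
    e (M.rot d) = N.rot (e d) := by
  rw [← faceStep_rev, hface, hrev, faceStep_rev]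

theorem faceStep_eq_of_rot_eq {e : M.Dart → N.Dart} (hrev : ∀ d, e (M.rev d) = N.rev (e d))
    (hrot : ∀ d, e (M.rot d) = N.rot (e d)) (d : M.Dart) :
    e (M.faceStep d) = N.faceStep (e d) := by
  rw [faceStep_apply, hrot, hrev, faceStep_apply]

theorem Iso.card_vertex (h : M.Iso N) : Nat.card M.Vertex = Nat.card N.Vertex := by
  obtain ⟨e, h1, _, _⟩ := h
  exact Nat.card_congr (sameCycleQuotientCongr e h1)

theorem Iso.card_edge (h : M.Iso N) : Nat.card M.Edge = Nat.card N.Edge := by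
  obtain ⟨e, _, h2, _⟩ := h
  exact Nat.card_congr (sameCycleQuotientCongr e h2)

theorem Iso.card_face (h : M.Iso N) : Nat.card M.Face = Nat.card N.Face := by
  obtain ⟨e, h1, h2, _⟩ := h
  exact Nat.card_congr (sameCycleQuotientCongr e (faceStep_eq_of_rot_eq h2 h1))

theorem Iso.isPlanarMap (h : M.Iso N) (hM : M.IsPlanarMap) : N.IsPlanarMap := by
  refine ⟨?_, by rw [← h.card_vertex, ← h.card_face, ← h.card_edge, hM.2]⟩
  obtain ⟨e, h1, h2, _⟩ := h
  refine hM.1.map e.surjective (fun d => ?_) fun d => ?_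
  · rw [h1]; exact linked_rot _
  · rw [h2]; exact linked_rev _

theorem Iso.isPlaneTree {m : ℕ} (h : M.Iso N) (hM : M.IsPlaneTree m) : N.IsPlaneTree m :=
  ⟨h.isPlanarMap hM.1, by rw [← h.card_face, hM.2.1], by rw [← h.card_edge, hM.2.2]⟩

theorem Iso.internal_faceDegree {q : ℕ} (h : M.Iso N)
    (hM : ∀ F : M.InternalFace, M.faceDegree F.1 = q) (F : N.InternalFace) :
    N.faceDegree F.1 = q := by
  obtain ⟨e, h1, h2, h3⟩ := h
  have hs : ∀ d d', N.faceStep.SameCycle (e d) (e d') ↔ M.faceStep.SameCycle d d' := fun d d' =>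
    sameCycle_iff_of_semiconj e.injective fun a => (faceStep_eq_of_rot_eq h2 h1 a).symm
  obtain ⟨F, hF⟩ := F
  obtain ⟨d, rfl⟩ := leftFace_surjective F
  obtain ⟨d, rfl⟩ := e.surjective d
  rw [rootFace, ← h3, ne_eq, leftFace_eq_iff, hs, ← leftFace_eq_iff] at hF
  rw [← hM ⟨_, hF⟩, faceDegree_leftFace, faceDegree_leftFace]
  exact (Nat.card_congr (e.subtypeEquiv fun d' => (hs d' d).symm)).symm

end RootedRotationSystem

/-! ### Cycles of the induced permutation -/

theorem sameCycle_inducedPerm {D : Type} [Finite D] {σ : Perm D} {T : Set D} {a b : T} :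
    (inducedPerm σ T).SameCycle a b ↔ σ.SameCycle (a : D) b := by
  constructor
  · refine sameCycle_map fun c => ?_
    obtain ⟨n, hn, _⟩ := firstReturn_spec σ T c
    rw [inducedPerm_apply, hn]
    exact (Perm.SameCycle.refl _ _).pow_right
  · intro h
    obtain ⟨n, hn⟩ := h.exists_nat_pow_eq
    clear h
    induction n using Nat.strong_induction_on generalizing a with
    | _ n ih =>
      rcases n with _ | n
      · rw [show a = b from Subtype.ext hn]
      · obtain ⟨p, hp, hp'⟩ := firstReturn_spec σ T a
        -- The first return cannot jump over `b`, which lies in `T`; after it strictly fewer steps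
        -- to `b` remain.
        have hle : p ≤ n := not_lt.1 fun hlt => hp' n hlt (hn ▸ b.2)
        refine Perm.sameCycle_apply_left.1 (ih (n - p) (by omega) ?_)
        rw [inducedPerm_apply, hp, ← Perm.mul_apply, ← pow_add, ← hn]
        congr 2
        omega

/-! ### The walk around a plane tree -/

namespace RootedRotationSystem

variable {M : RootedRotationSystem}

variable (M) in
/-- The walk around the complement of a plane tree, in the opposite direction to the face walk. -/
def holeStep : Perm M.Dart := M.rev.trans M.rot.symm

theorem holeStep_apply (d : M.Dart) : M.holeStep d = M.rot.symm (M.rev d) := rfl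

/-- `holeStep` is the inverse face walk conjugated by `rev`, and with a single face the face walk is
transitive. -/
theorem holeStep_sameCycle (h : Nat.card M.Face = 1) (d d' : M.Dart) :
    M.holeStep.SameCycle d d' := by
  have hs := (Nat.card_eq_one_iff_unique.1 h).1
  have h1 : M.faceStep⁻¹.SameCycle (M.rev d) (M.rev d') :=
    (leftFace_eq_iff.1 (Subsingleton.elim _ _)).inv
  have h2 := sameCycle_map (f' := M.holeStep) (g := M.rev) (fun a => ?_) h1
  · rwa [M.rev_rev, M.rev_rev] at h2
  · obtain ⟨a, rfl⟩ := M.faceStep.surjective a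
    rw [show M.faceStep⁻¹ (M.faceStep a) = a from M.faceStep.symm_apply_apply a]
    rw [show M.rev a = M.holeStep (M.rev (M.faceStep a)) by
      rw [holeStep_apply, M.rev_rev, faceStep_apply, Equiv.symm_apply_apply]]
    exact (Perm.SameCycle.refl _ _).apply_right

end RootedRotationSystem

namespace DecoratedRotationSystem

open RootedRotationSystem

variable {X : DecoratedRotationSystem}

/-! ### The oriented edges of the unglued map -/

/-- The oriented edge of the unglued map that keeps the face on the left of `d`. -/
def old (X : DecoratedRotationSystem) (d : X.Dart) : X.unglued.Dart := Sum.inl d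

/-- The new oriented edge of the unglued map that is parallel to `a`. -/
def new (X : DecoratedRotationSystem) (a : X.submap.Dart) : X.unglued.Dart := Sum.inr a

/-- The inclusion of the decoration. -/
def incl (X : DecoratedRotationSystem) (a : X.submap.Dart) : X.Dart := Subtype.val a

theorem old_injective : Function.Injective X.old := Sum.inl_injective

theorem new_injective : Function.Injective X.new := Sum.inr_injective

theorem old_ne_new (d : X.Dart) (a : X.submap.Dart) : X.old d ≠ X.new a := Sum.inl_ne_inr

theorem old_or_new (x : X.unglued.Dart) : (∃ d, X.old d = x) ∨ ∃ a, X.new a = x := by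
  rcases x with d | a
  · exact Or.inl ⟨d, rfl⟩
  · exact Or.inr ⟨a, rfl⟩

theorem incl_mem (a : X.submap.Dart) : X.incl a ∈ X.deco := Subtype.property a

theorem exists_incl_eq {d : X.Dart} (h : d ∈ X.deco) : ∃ a, X.incl a = d := ⟨⟨d, h⟩, rfl⟩

theorem incl_rev (a : X.submap.Dart) : X.incl (X.submap.rev a) = X.rev (X.incl a) := rfl

theorem card_unglued_dart : Nat.card X.unglued.Dart = Nat.card X.Dart + Nat.card X.submap.Dart :=
  Nat.card_sum

theorem sameCycle_submap_rot {a b : X.submap.Dart} :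
    X.submap.rot.SameCycle a b ↔ X.rot.SameCycle (X.incl a) (X.incl b) := sameCycle_inducedPerm

theorem submap_rot_spec (a : X.submap.Dart) : ∃ n : ℕ,
    X.incl (X.submap.rot a) = (X.rot ^ (n + 1)) (X.incl a) ∧
      ∀ k < n, (X.rot ^ (k + 1)) (X.incl a) ∉ X.deco := firstReturn_spec X.rot X.deco a

/-! ### The steps of the unglued map -/

theorem unglued_root : X.unglued.root = X.new X.submap.root := rfl

theorem unglued_rev_old_incl (a : X.submap.Dart) :
    X.unglued.rev (X.old (X.incl a)) = X.new (X.submap.rev a) :=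
  dif_pos (incl_mem a)

theorem unglued_rev_old {d : X.Dart} (h : d ∉ X.deco) :
    X.unglued.rev (X.old d) = X.old (X.rev d) :=
  dif_neg h

theorem unglued_rev_new (a : X.submap.Dart) :
    X.unglued.rev (X.new a) = X.old (X.incl (X.submap.rev a)) := rfl

theorem unglued_rot_old_incl (a : X.submap.Dart) :
    X.unglued.rot (X.old (X.incl a)) = X.new (X.submap.rot.symm a) :=
  dif_pos (incl_mem a)

theorem unglued_rot_old {d : X.Dart} (h : d ∉ X.deco) :
    X.unglued.rot (X.old d) = X.old (X.rot d) :=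
  dif_neg h

theorem unglued_rot_new (a : X.submap.Dart) :
    X.unglued.rot (X.new a) = X.old (X.rot (X.incl a)) := rfl

/-- At a decorating edge the reversal passes to the new side and the rotation comes straight back to
an old edge, so the detour cancels. -/
theorem unglued_faceStep_old (d : X.Dart) :
    X.unglued.faceStep (X.old d) = X.old (X.faceStep d) := by
  rw [faceStep_apply, faceStep_apply]
  by_cases h : d ∈ X.deco
  · obtain ⟨a, rfl⟩ := exists_incl_eq h
    rw [unglued_rev_old_incl, unglued_rot_new, incl_rev]
  · rw [unglued_rev_old h, unglued_rot_old fun h' => h ((X.rev_mem_iff d).1 h')]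

theorem unglued_faceStep_new (a : X.submap.Dart) :
    X.unglued.faceStep (X.new a) = X.new (X.submap.holeStep a) := by
  rw [faceStep_apply, unglued_rev_new, unglued_rot_old_incl, holeStep_apply]

/-! ### Faces of the unglued map -/

theorem unglued_sameCycle_faceStep_old {d d' : X.Dart} :
    X.unglued.faceStep.SameCycle (X.old d) (X.old d') ↔ X.faceStep.SameCycle d d' :=
  sameCycle_iff_of_semiconj (g := X.old) old_injective
    unglued_faceStep_old

theorem unglued_not_sameCycle_faceStep {d : X.Dart} {a : X.submap.Dart} :
    ¬ X.unglued.faceStep.SameCycle (X.old d) (X.new a) := by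
  intro h
  have := sameCycle_induction (P := fun x => ∃ d, X.old d = x) ?_ h ⟨d, rfl⟩
  · obtain ⟨d, hd⟩ := this
    exact old_ne_new _ _ hd
  · rintro _ ⟨d, rfl⟩
    exact ⟨X.faceStep d, (unglued_faceStep_old d).symm⟩

theorem unglued_leftFace_old_ne (d : X.Dart) :
    X.unglued.leftFace (X.old d) ≠ X.unglued.rootFace := fun h =>
  unglued_not_sameCycle_faceStep (leftFace_eq_iff.1 h)

theorem unglued_leftFace_new (h : Nat.card X.submap.Face = 1) (a : X.submap.Dart) :
    X.unglued.leftFace (X.new a) = X.unglued.rootFace := by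
  refine leftFace_eq_iff.2 (sameCycle_map (f := X.submap.holeStep) (f' := X.unglued.faceStep)
    (g := X.new) (fun b => ?_) (holeStep_sameCycle h a _))
  rw [← unglued_faceStep_new]
  exact (Perm.SameCycle.refl _ _).apply_right

theorem unglued_leftFace_eq_rootFace_iff (h : Nat.card X.submap.Face = 1) {x : X.unglued.Dart} :
    X.unglued.leftFace x = X.unglued.rootFace ↔ ∃ a : X.submap.Dart, x = X.new a := by
  constructor
  · intro hx
    obtain ⟨d, rfl⟩ | ⟨a, rfl⟩ := old_or_new x
    · exact absurd hx (unglued_leftFace_old_ne d)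
    · exact ⟨a, rfl⟩
  · rintro ⟨a, rfl⟩
    exact unglued_leftFace_new h a

/-- The internal face of the unglued map that a face of the original map becomes. -/
noncomputable def toInternalFace (X : DecoratedRotationSystem) : X.Face → X.unglued.InternalFace :=
  Quotient.lift (fun d : X.Dart => ⟨X.unglued.leftFace (X.old d), unglued_leftFace_old_ne d⟩)
    fun _ _ h => Subtype.ext (leftFace_eq_iff.2 (unglued_sameCycle_faceStep_old.2 h))

theorem toInternalFace_leftFace (d : X.Dart) :
    (X.toInternalFace (X.leftFace d)).1 = X.unglued.leftFace (X.old d) := rfl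

theorem toInternalFace_bijective (h : Nat.card X.submap.Face = 1) :
    Function.Bijective X.toInternalFace := by
  constructor
  · intro F F' hF
    obtain ⟨d, rfl⟩ := leftFace_surjective F
    obtain ⟨d', rfl⟩ := leftFace_surjective F'
    exact leftFace_eq_iff.2 (unglued_sameCycle_faceStep_old.1
      (leftFace_eq_iff.1 (congrArg Subtype.val hF)))
  · rintro ⟨F, hF⟩
    obtain ⟨x, rfl⟩ := leftFace_surjective F
    obtain ⟨d, rfl⟩ | ⟨a, rfl⟩ := old_or_new x
    · exact ⟨X.leftFace d, rfl⟩
    · exact absurd (unglued_leftFace_new h a) hF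

theorem faceDegree_toInternalFace (F : X.Face) :
    X.unglued.faceDegree (X.toInternalFace F).1 = X.faceDegree F := by
  obtain ⟨d, rfl⟩ := leftFace_surjective F
  rw [toInternalFace_leftFace, faceDegree_leftFace, faceDegree_leftFace]
  symm
  refine Nat.card_congr (Equiv.ofBijective
    (fun x => ⟨X.old x.1, unglued_sameCycle_faceStep_old.2 x.2⟩) ⟨fun x y hxy => ?_, ?_⟩)
  · exact Subtype.ext (old_injective (congrArg Subtype.val hxy))
  · rintro ⟨x, hx⟩
    obtain ⟨x, rfl⟩ | ⟨a, rfl⟩ := old_or_new x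
    · exact ⟨⟨x, unglued_sameCycle_faceStep_old.1 hx⟩, rfl⟩
    · exact absurd hx.symm unglued_not_sameCycle_faceStep

theorem card_face_unglued (h : Nat.card X.submap.Face = 1) :
    Nat.card X.unglued.Face = Nat.card X.Face + 1 := by
  classical
  rw [← Nat.card_congr (Equiv.sumCompl fun F : X.unglued.Face => F = X.unglued.rootFace),
    Nat.card_sum, Nat.card_unique,
    Nat.card_congr (Equiv.ofBijective _ (toInternalFace_bijective h)), add_comm]
  rfl

theorem faceDegree_rootFace_unglued (h : Nat.card X.submap.Face = 1) :
    X.unglued.faceDegree X.unglued.rootFace = Nat.card X.submap.Dart := by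
  symm
  refine Nat.card_congr (Equiv.ofBijective
    (fun a => ⟨X.new a, unglued_leftFace_new h a⟩) ⟨fun x y hxy => ?_, ?_⟩)
  · exact new_injective (congrArg Subtype.val hxy)
  · rintro ⟨x, hx⟩
    obtain ⟨a, rfl⟩ := (unglued_leftFace_eq_rootFace_iff h).1 hx
    exact ⟨a, rfl⟩

/-! ### Edges of the unglued map -/

/-- Counting oriented edges suffices, since each edge has exactly two. -/
theorem card_edge_unglued :
    Nat.card X.unglued.Edge = Nat.card X.Edge + Nat.card X.submap.Edge := by
  have h1 := X.unglued.card_dart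
  have h2 := X.toRootedRotationSystem.card_dart
  have h3 := X.submap.card_dart
  have h4 := card_unglued_dart (X := X)
  omega

/-! ### Vertices of the unglued map -/

/-- The orbit of `X.new a` is one corner: the old edges after `a` up to the next decorating edge,
then `X.new a` again. So distinct corners are distinct vertices, which is the simplicity of the
boundary. -/
theorem unglued_sameCycle_rot_new {a b : X.submap.Dart}
    (h : X.unglued.rot.SameCycle (X.new a) (X.new b)) : a = b := by
  obtain ⟨n, hn, hn'⟩ := submap_rot_spec a
  have := sameCycle_induction (P := fun x =>
    x = X.new a ∨ ∃ k ≤ n, x = X.old ((X.rot ^ (k + 1)) (X.incl a))) ?_ h (Or.inl rfl)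
  · rcases this with h | ⟨k, _, h⟩
    · exact (new_injective h).symm
    · exact absurd h.symm (old_ne_new _ _)
  · rintro x (rfl | ⟨k, hk, rfl⟩)
    · exact Or.inr ⟨0, Nat.zero_le _, by rw [unglued_rot_new]; rfl⟩
    · rcases hk.lt_or_eq with hk | rfl
      · refine Or.inr ⟨k + 1, hk, ?_⟩
        rw [unglued_rot_old (hn' k hk), pow_succ' _ (k + 1), Perm.mul_apply]
      · refine Or.inl ?_
        rw [← hn, unglued_rot_old_incl, Equiv.symm_apply_apply]

/-- Gluing back sends a new oriented edge to the decorating edge it is parallel to. -/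
def glue (X : DecoratedRotationSystem) : X.unglued.Dart → X.Dart :=
  Sum.elim (fun d => d) X.incl

theorem glue_old (d : X.Dart) : X.glue (X.old d) = d := rfl

theorem glue_new (a : X.submap.Dart) : X.glue (X.new a) = X.incl a := rfl

theorem sameCycle_rot_glue (x : X.unglued.Dart) :
    X.rot.SameCycle (X.glue x) (X.glue (X.unglued.rot x)) := by
  obtain ⟨d, rfl⟩ | ⟨a, rfl⟩ := old_or_new x
  · by_cases h : d ∈ X.deco
    · obtain ⟨d, rfl⟩ := exists_incl_eq h
      rw [unglued_rot_old_incl, glue_old, glue_new]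
      exact sameCycle_submap_rot.1 (Perm.SameCycle.refl _ _).symm_apply_right
    · rw [unglued_rot_old h]
      exact (Perm.SameCycle.refl _ _).apply_right
  · rw [unglued_rot_new]
    exact (Perm.SameCycle.refl _ _).apply_right

theorem unglued_sameCycle_rot_old_of_forall_notMem {d d' : X.Dart}
    (hd : ∀ a ∈ X.deco, ¬ X.rot.SameCycle a d) (h : X.rot.SameCycle d d') :
    X.unglued.rot.SameCycle (X.old d) (X.old d') := by
  refine (sameCycle_induction (f := X.rot) (P := fun x => X.rot.SameCycle d x ∧
    X.unglued.rot.SameCycle (X.old d) (X.old x)) ?_ h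
    ⟨Perm.SameCycle.refl _ _, Perm.SameCycle.refl _ _⟩).2
  rintro x ⟨h1, h2⟩
  refine ⟨h1.apply_right, ?_⟩
  rw [← unglued_rot_old fun hx => hd x hx h1.symm]
  exact h2.apply_right

/-- Going counterclockwise from a decorating edge, either the corner is unchanged, or a decorating
edge is met, whose successor in the unglued map is new. So every corner at a tree vertex has a new
edge. -/
theorem exists_unglued_sameCycle_rot_new {a : X.submap.Dart} {d : X.Dart}
    (h : X.rot.SameCycle d (X.incl a)) :
    ∃ b : X.submap.Dart, X.unglued.rot.SameCycle (X.new b) (X.old d) := by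
  refine sameCycle_induction (f := X.rot⁻¹)
    (P := fun x => ∃ b : X.submap.Dart, X.unglued.rot.SameCycle (X.new b) (X.old x)) ?_ h.symm.inv ?_
  · rintro x ⟨b, hb⟩
    obtain ⟨x, rfl⟩ := X.rot.surjective x
    rw [show X.rot⁻¹ (X.rot x) = x from X.rot.symm_apply_apply x]
    by_cases hx : x ∈ X.deco
    · obtain ⟨x, rfl⟩ := exists_incl_eq hx
      refine ⟨X.submap.rot.symm x, ?_⟩
      rw [← unglued_rot_old_incl]
      exact (Perm.SameCycle.refl _ _).apply_left
    · rw [← unglued_rot_old hx] at hb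
      exact ⟨b, hb.of_apply_right⟩
  · refine ⟨X.submap.rot.symm a, ?_⟩
    rw [← unglued_rot_old_incl]
    exact (Perm.SameCycle.refl _ _).apply_left

theorem card_vertex_submap :
    Nat.card X.submap.Vertex = Nat.card {v : X.Vertex // ∃ a : X.submap.Dart, X.source (X.incl a) = v} := by
  refine Nat.card_congr (Equiv.ofBijective (Quotient.lift (fun a : X.submap.Dart =>
    (⟨X.source (X.incl a), a, rfl⟩ : {v : X.Vertex // ∃ a : X.submap.Dart, X.source (X.incl a) = v}))
    fun a b h => Subtype.ext (source_eq_iff.2 (sameCycle_submap_rot.1 h))) ⟨?_, ?_⟩)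
  · intro v w h
    obtain ⟨a, rfl⟩ := source_surjective v
    obtain ⟨b, rfl⟩ := source_surjective w
    exact source_eq_iff.2 (sameCycle_submap_rot.2 (source_eq_iff.1 (congrArg Subtype.val h)))
  · rintro ⟨_, a, rfl⟩
    exact ⟨X.submap.source a, rfl⟩

theorem card_unglued_vertex_of_new :
    Nat.card {v : X.unglued.Vertex // ∃ a : X.submap.Dart, X.unglued.source (X.new a) = v} =
      Nat.card X.submap.Dart := by
  symm
  refine Nat.card_congr (Equiv.ofBijective
    (fun a => ⟨X.unglued.source (X.new a), a, rfl⟩) ⟨fun a b h => ?_, ?_⟩)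
  · exact unglued_sameCycle_rot_new (source_eq_iff.1 (congrArg Subtype.val h))
  · rintro ⟨_, a, rfl⟩
    exact ⟨a, rfl⟩

theorem card_unglued_vertex_of_not_new :
    Nat.card {v : X.unglued.Vertex // ¬ ∃ a : X.submap.Dart, X.unglued.source (X.new a) = v} =
      Nat.card {v : X.Vertex // ¬ ∃ a : X.submap.Dart, X.source (X.incl a) = v} := by
  -- Gluing back on vertices: it merges the corners of each tree vertex and is a bijection away from
  -- the tree.
  let p : X.unglued.Vertex → X.Vertex := Quotient.lift (fun x => X.source (X.glue x))
    fun x y h => source_eq_iff.2 (sameCycle_map sameCycle_rot_glue h)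
  have hmem : ∀ v, (¬ ∃ a : X.submap.Dart, X.unglued.source (X.new a) = v) →
      ¬ ∃ a : X.submap.Dart, X.source (X.incl a) = p v := by
    rintro v hv ⟨a, ha⟩
    obtain ⟨x, rfl⟩ := source_surjective v
    obtain ⟨d, rfl⟩ | ⟨b, rfl⟩ := old_or_new x
    · obtain ⟨b, hb⟩ := exists_unglued_sameCycle_rot_new (source_eq_iff.1 ha).symm
      exact hv ⟨b, source_eq_iff.2 hb⟩
    · exact hv ⟨b, rfl⟩
  refine Nat.card_congr (Equiv.ofBijective (fun v => ⟨p v.1, hmem v.1 v.2⟩) ⟨?_, ?_⟩)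
  · rintro ⟨v, hv⟩ ⟨w, hw⟩ h
    have h' : p v = p w := congrArg Subtype.val h
    refine Subtype.ext ?_
    have hv' := hmem v hv
    obtain ⟨x, rfl⟩ := source_surjective v
    obtain ⟨d, rfl⟩ | ⟨b, rfl⟩ := old_or_new x
    · obtain ⟨y, rfl⟩ := source_surjective w
      obtain ⟨d', rfl⟩ | ⟨b, rfl⟩ := old_or_new y
      · refine source_eq_iff.2 (unglued_sameCycle_rot_old_of_forall_notMem
          (fun a ha hs => hv' ⟨⟨a, ha⟩, source_eq_iff.2 hs⟩) (source_eq_iff.1 h'))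
      · exact absurd ⟨b, rfl⟩ hw
    · exact absurd ⟨b, rfl⟩ hv
  · rintro ⟨v, hv⟩
    obtain ⟨d, rfl⟩ := source_surjective v
    refine ⟨⟨X.unglued.source (X.old d), ?_⟩, rfl⟩
    rintro ⟨a, ha⟩
    exact hv ⟨a, congrArg p ha⟩

/-- Vertices off the tree are untouched, while those on it are replaced by their corners, one per
oriented edge of the decoration. -/
theorem card_vertex_unglued :
    Nat.card X.unglued.Vertex + Nat.card X.submap.Vertex =
      Nat.card X.Vertex + Nat.card X.submap.Dart := by
  classical
  rw [← Nat.card_congr (Equiv.sumCompl fun v : X.unglued.Vertex =>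
      ∃ a : X.submap.Dart, X.unglued.source (X.new a) = v),
    ← Nat.card_congr (Equiv.sumCompl fun v : X.Vertex => ∃ a : X.submap.Dart, X.source (X.incl a) = v),
    Nat.card_sum, Nat.card_sum, card_unglued_vertex_of_new, card_unglued_vertex_of_not_new,
    card_vertex_submap]
  omega

/-! ### Planarity of the unglued map -/

theorem isConnected_of_unglued (h : X.unglued.IsConnected) :
    X.toRootedRotationSystem.IsConnected := by
  refine h.map (p := X.glue) (fun d => ⟨X.old d, rfl⟩)
    (fun x => linked_of_sameCycle_rot (sameCycle_rot_glue x)) ?_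
  intro x
  obtain ⟨d, rfl⟩ | ⟨a, rfl⟩ := old_or_new x
  · by_cases h : d ∈ X.deco
    · obtain ⟨d, rfl⟩ := exists_incl_eq h
      rw [unglued_rev_old_incl]
      exact linked_rev (M := X.toRootedRotationSystem) (X.incl d)
    · rw [unglued_rev_old h]
      exact linked_rev (M := X.toRootedRotationSystem) d
  · exact linked_rev (M := X.toRootedRotationSystem) (X.incl a)

/-- Cutting separates the two sides of a decorating edge, but each side borders the hole, and the
hole has a connected boundary because it is one face. -/
theorem isConnected_unglued (ht : Nat.card X.submap.Face = 1)
    (h : X.toRootedRotationSystem.IsConnected) : X.unglued.IsConnected := by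
  have hface : ∀ d : X.Dart, X.unglued.Linked (X.old d) (X.old (X.faceStep d)) := fun d => by
    rw [← unglued_faceStep_old]
    exact linked_faceStep _
  have hinr : ∀ a b : X.submap.Dart, X.unglued.Linked (X.new a) (X.new b) := fun a b => by
    refine linked_of_sameCycle_faceStep (leftFace_eq_iff.1 ?_)
    rw [unglued_leftFace_new ht, unglued_leftFace_new ht]
  have hmem : ∀ a b : X.submap.Dart, X.unglued.Linked (X.old (X.incl a)) (X.new b) := fun a b => by
    refine Linked.trans ?_ (hinr (X.submap.rev a) b)
    rw [← unglued_rev_old_incl]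
    exact linked_rev _
  have hrev : ∀ d : X.Dart, X.unglued.Linked (X.old d) (X.old (X.rev d)) := fun d => by
    by_cases h : d ∈ X.deco
    · obtain ⟨d, rfl⟩ := exists_incl_eq h
      exact (hmem d d).trans (hmem (X.submap.rev d) d).symm
    · rw [← unglued_rev_old h]
      exact linked_rev _
  have hinl : ∀ d d' : X.Dart, X.unglued.Linked (X.old d) (X.old d') := fun d d' => by
    refine Linked.map (M := X.toRootedRotationSystem) (p := X.old) (fun d => ?_) hrev (h d d')
    refine (hrev d).trans ?_
    rw [← faceStep_rev]
    exact hface _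
  intro x y
  obtain ⟨d, rfl⟩ | ⟨a, rfl⟩ := old_or_new x <;> obtain ⟨d', rfl⟩ | ⟨b, rfl⟩ := old_or_new y
  · exact hinl d d'
  · exact (hinl d (X.incl b)).trans (hmem b b)
  · exact (hmem a a).symm.trans (hinl (X.incl a) d')
  · exact hinr a b

/-- The Euler characteristic changes by 2m - (m + 1) - m + 1 = 0, where m + 1 is the number of
vertices of the tree. -/
theorem isPlanarMap_unglued_iff {m : ℕ} (ht : X.submap.IsPlaneTree m) :
    X.unglued.IsPlanarMap ↔ X.toRootedRotationSystem.IsPlanarMap := by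
  have h1 := card_vertex_unglued (X := X)
  have h2 := card_edge_unglued (X := X)
  have h3 := card_face_unglued ht.2.1
  have h4 := ht.1.2
  have h5 : Nat.card X.submap.Dart = 2 * Nat.card X.submap.Edge := X.submap.card_dart
  have h6 := ht.2.1
  refine and_congr ⟨isConnected_of_unglued, isConnected_unglued ht.2.1⟩ ?_
  omega

theorem unglued_isAngulationWithSimpleBoundary {q m : ℕ} (h : X.IsTreeDecoratedAngulation q m) :
    X.unglued.IsAngulationWithSimpleBoundary q (2 * m) := by
  have ht := h.2.2.1
  refine ⟨⟨(isPlanarMap_unglued_iff h.2).2 h.1.1, ?_, ?_, ?_⟩, ?_⟩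
  · rw [faceDegree_rootFace_unglued ht, ← h.2.2.2]
    exact X.submap.card_dart
  · intro x y hx hy hxy
    obtain ⟨a, rfl⟩ := (unglued_leftFace_eq_rootFace_iff ht).1 hx
    obtain ⟨b, rfl⟩ := (unglued_leftFace_eq_rootFace_iff ht).1 hy
    rw [unglued_sameCycle_rot_new (source_eq_iff.1 hxy)]
  · intro x hx
    obtain ⟨a, rfl⟩ := (unglued_leftFace_eq_rootFace_iff ht).1 hx
    exact unglued_leftFace_old_ne _
  · intro F
    obtain ⟨F, rfl⟩ := (toInternalFace_bijective ht).2 F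
    rw [faceDegree_toInternalFace, h.1.2]

theorem isTreeDecoratedAngulation_of_unglued {q m : ℕ} (ht : X.submap.IsPlaneTree m)
    (h : X.unglued.IsPlanarMap) (hq : ∀ F : X.unglued.InternalFace, X.unglued.faceDegree F.1 = q) :
    X.IsTreeDecoratedAngulation q m :=
  ⟨⟨(isPlanarMap_unglued_iff ht).1 h, fun F => by rw [← faceDegree_toInternalFace, hq]⟩, ht⟩

/-! ### The unglued map and the tree determine the decorated map -/

theorem iso_of_unglued_iso {Y : DecoratedRotationSystem} (hX : Nat.card X.submap.Face = 1)
    (ht : X.submap.Iso Y.submap) (hu : X.unglued.Iso Y.unglued) : X.Iso Y := by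
  obtain ⟨f, f1, f2, f3⟩ := hu
  obtain ⟨g, g1, g2, g3⟩ := ht
  have f4 := faceStep_eq_of_rot_eq f2 f1
  have g4 : ∀ a, g (X.submap.holeStep a) = Y.submap.holeStep (g a) := fun a => by
    rw [holeStep_apply, holeStep_apply, Equiv.eq_symm_apply, ← g1, Equiv.apply_symm_apply, g2]
  have hinr : ∀ a : X.submap.Dart, f (X.new a) = Y.new (g a) := by
    intro a
    refine sameCycle_induction (f := X.submap.holeStep)
      (P := fun a : X.submap.Dart => f (X.new a) = Y.new (g a)) (fun a ha => ?_)
      (holeStep_sameCycle hX X.submap.root a) ?_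
    · rw [← unglued_faceStep_new, f4, ha, unglued_faceStep_new, g4]
    · rw [g3]
      exact f3
  have hinl : ∀ d : X.Dart, ∃ d' : Y.Dart, f (X.old d) = Y.old d' := by
    intro d
    obtain ⟨d', hd⟩ | ⟨b, hd⟩ := old_or_new (f (X.old d))
    · exact ⟨d', hd.symm⟩
    · obtain ⟨a, rfl⟩ := g.surjective b
      rw [← hinr a] at hd
      exact absurd (f.injective hd.symm) (old_ne_new _ _)
  choose e he using hinl
  have hbij : Function.Bijective e := by
    constructor
    · intro d d' h
      refine old_injective (f.injective ?_)
      rw [he, he, h]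
    · intro d'
      obtain ⟨x, hx⟩ := f.surjective (Y.old d')
      obtain ⟨d, rfl⟩ | ⟨a, rfl⟩ := old_or_new x
      · exact ⟨d, old_injective ((he d).symm.trans hx)⟩
      · rw [hinr] at hx
        exact absurd hx.symm (old_ne_new _ _)
  have heg : ∀ a : X.submap.Dart, e (X.incl a) = Y.incl (g a) := by
    intro a
    -- An old decorating edge is the reversal of a new edge, where `f` is already known to be `g`.
    obtain ⟨a, rfl⟩ := X.submap.rev.surjective a
    refine old_injective ((he _).symm.trans ?_)
    rw [← unglued_rev_new, f2, hinr, unglued_rev_new, g2]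
  have hmem : ∀ d, d ∈ X.deco ↔ e d ∈ Y.deco := by
    intro d
    refine ⟨fun h => ?_, fun h => ?_⟩
    · obtain ⟨a, rfl⟩ := exists_incl_eq h
      rw [heg]
      exact incl_mem _
    · obtain ⟨b, hb⟩ := exists_incl_eq h
      obtain ⟨a, rfl⟩ := g.surjective b
      rw [← heg] at hb
      rw [← hbij.1 hb]
      exact incl_mem _
  have hrev : ∀ d, e (X.rev d) = Y.rev (e d) := by
    intro d
    by_cases h : d ∈ X.deco
    · obtain ⟨d, rfl⟩ := exists_incl_eq h
      rw [heg, ← incl_rev, heg, g2, incl_rev]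
    · refine old_injective ((he _).symm.trans ?_)
      rw [← unglued_rev_old h, f2, he,
        unglued_rev_old fun h' => h ((hmem d).2 h')]
  have hface : ∀ d, e (X.faceStep d) = Y.faceStep (e d) := by
    intro d
    refine old_injective ((he _).symm.trans ?_)
    rw [← unglued_faceStep_old, f4, he, unglued_faceStep_old]
  exact ⟨Equiv.ofBijective e hbij, rot_eq_of_faceStep_eq hrev hface, hrev,
    (heg X.submap.root).trans (congrArg Y.incl g3), hmem⟩

end DecoratedRotationSystem

/-- A labelling of the oriented edges of the root face of `B`, whose boundary is simple, by those of
the tree `T`, in the order in which one walks around the complement of the tree. -/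
structure BoundaryLabelling (T B : RootedRotationSystem) where
  label : T.Dart → B.Dart
  injective : Function.Injective label
  leftFace_eq_iff : ∀ d, B.leftFace d = B.rootFace ↔ ∃ a, label a = d
  label_holeStep : ∀ a, label (T.holeStep a) = B.faceStep (label a)
  label_root : label T.root = B.root
  eq_of_sameCycle : ∀ a b, B.rot.SameCycle (label a) (label b) → a = b
  rev_ne : ∀ a b, label b ≠ B.rev (label a)

/-! ### Gluing a simple boundary along a plane tree -/

namespace BoundaryLabelling

open RootedRotationSystem DecoratedRotationSystem

variable {T B : RootedRotationSystem}

/-- The walk around the tree and the walk along the root face are both cycles of length 2m, hence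
conjugate with the roots matched. -/
theorem nonempty_of_simpleBoundary {m : ℕ} (hT : T.IsPlaneTree m)
    (hB : B.HasSimpleBoundary (2 * m)) : Nonempty (BoundaryLabelling T B) := by
  have hstep : ∀ d, B.leftFace (B.faceStep d) = B.rootFace ↔ B.leftFace d = B.rootFace :=
    fun d => by rw [leftFace_faceStep]
  obtain ⟨h, h0, h1⟩ := exists_equiv_of_transitive (f := T.holeStep)
    (f' := B.faceStep.subtypePerm (p := fun d => B.leftFace d = B.rootFace) hstep) (holeStep_sameCycle hT.2.1)
    (fun x y => Perm.sameCycle_subtypePerm.2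
      (RootedRotationSystem.leftFace_eq_iff.1 (x.2.trans y.2.symm)))
    (by rw [card_dart, hT.2.2, ← hB.2.1]; rfl) T.root ⟨B.root, rfl⟩
  exact ⟨{
    label := fun a => (h a).1
    injective := Subtype.val_injective.comp h.injective
    leftFace_eq_iff := fun d => ⟨fun hd => ⟨h.symm ⟨d, hd⟩, by rw [Equiv.apply_symm_apply]⟩,
      by rintro ⟨a, rfl⟩; exact (h a).2⟩
    label_holeStep := fun a => by rw [h1]; rfl
    label_root := by rw [h0]
    eq_of_sameCycle := fun a b hab => h.injective (Subtype.ext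
      (hB.2.2.1 _ _ (h a).2 (h b).2 (source_eq_iff.2 hab)))
    rev_ne := fun a b hab => hB.2.2.2 _ (h a).2 (hab ▸ (h b).2) }⟩

variable (l : BoundaryLabelling T B)

/-- The oriented edges that are kept when the boundary is glued. -/
abbrev Kept : Type := {d : B.Dart // ∀ a, l.label a ≠ d}

/-- The oriented edge of the glued map that an oriented edge of the tree becomes. -/
def side (a : T.Dart) : l.Kept := ⟨B.rev (l.label (T.rev a)), fun b => l.rev_ne _ b⟩

theorem side_val (a : T.Dart) : (l.side a).1 = B.rev (l.label (T.rev a)) := rfl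

theorem side_injective : Function.Injective l.side := fun _ _ h =>
  T.rev.injective (l.injective (B.rev.injective (congrArg Subtype.val h)))

theorem label_ne_rev {d : l.Kept} (h : ¬ ∃ a, l.side a = d) (a : T.Dart) :
    l.label a ≠ B.rev d.1 := fun ha => h ⟨T.rev a, Subtype.ext (by
      rw [side_val, T.rev_rev, ha, B.rev_rev])⟩

open Classical in
/-- The reversal of the glued map. -/
noncomputable def gluedRevFun (d : l.Kept) : l.Kept :=
  if h : ∃ a, l.side a = d then l.side (T.rev h.choose) else ⟨B.rev d.1, l.label_ne_rev h⟩

theorem gluedRevFun_side (a : T.Dart) : l.gluedRevFun (l.side a) = l.side (T.rev a) := by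
  have h : ∃ b, l.side b = l.side a := ⟨a, rfl⟩
  rw [gluedRevFun, dif_pos h, l.side_injective h.choose_spec]

theorem gluedRevFun_val {d : l.Kept} (h : ¬ ∃ a, l.side a = d) :
    (l.gluedRevFun d).1 = B.rev d.1 := by
  rw [gluedRevFun, dif_neg h]

theorem gluedRevFun_gluedRevFun (d : l.Kept) : l.gluedRevFun (l.gluedRevFun d) = d := by
  by_cases h : ∃ a, l.side a = d
  · obtain ⟨a, rfl⟩ := h
    rw [gluedRevFun_side, gluedRevFun_side, T.rev_rev]
  · refine Subtype.ext ?_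
    rw [gluedRevFun_val, gluedRevFun_val l h, B.rev_rev]
    rintro ⟨a, ha⟩
    have := congrArg Subtype.val ha
    rw [gluedRevFun_val l h, side_val] at this
    exact d.2 _ (B.rev.injective this)

theorem gluedRevFun_ne (d : l.Kept) : l.gluedRevFun d ≠ d := by
  by_cases h : ∃ a, l.side a = d
  · obtain ⟨a, rfl⟩ := h
    rw [gluedRevFun_side]
    exact fun h => T.rev_ne a (l.side_injective h)
  · intro hd
    have := congrArg Subtype.val hd
    rw [gluedRevFun_val l h] at this
    exact B.rev_ne _ this

theorem kept_faceStep (d : B.Dart) :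
    (∀ a, l.label a ≠ B.faceStep d) ↔ ∀ a, l.label a ≠ d := by
  rw [← not_exists, ← not_exists, ← l.leftFace_eq_iff, ← l.leftFace_eq_iff, leftFace_faceStep]

/-- The face walk of the glued map. -/
def gluedFaceStep : Perm l.Kept := B.faceStep.subtypePerm l.kept_faceStep

/-- The map obtained by gluing the boundary of `B` along the tree `T`. -/
noncomputable def glued : DecoratedRotationSystem where
  Dart := l.Kept
  -- The rotation is forced by the new reversal and the inherited face walk.
  rot := (Function.Involutive.toPerm _ l.gluedRevFun_gluedRevFun).trans l.gluedFaceStep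
  rev := Function.Involutive.toPerm _ l.gluedRevFun_gluedRevFun
  rev_rev := l.gluedRevFun_gluedRevFun
  rev_ne := l.gluedRevFun_ne
  root := l.side T.root
  deco := {d | ∃ a, l.side a = d}
  rev_mem := by
    rintro _ ⟨a, rfl⟩
    exact ⟨T.rev a, (l.gluedRevFun_side a).symm⟩
  root_mem := ⟨_, rfl⟩

/-- The oriented edge of `B` that becomes a given oriented edge of the glued map. -/
def lift (d : l.glued.Dart) : B.Dart := Subtype.val (p := fun d => ∀ a, l.label a ≠ d) d

theorem lift_injective : Function.Injective l.lift := Subtype.val_injective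

theorem label_ne_lift (a : T.Dart) (d : l.glued.Dart) : l.label a ≠ l.lift d :=
  Subtype.property (p := fun d => ∀ a, l.label a ≠ d) d a

theorem label_or_lift (x : B.Dart) : (∃ a, l.label a = x) ∨ ∃ d, l.lift d = x := by
  by_cases h : ∃ a, l.label a = x
  · exact Or.inl h
  · exact Or.inr ⟨⟨x, fun a ha => h ⟨a, ha⟩⟩, rfl⟩

/-- The oriented edge of the decoration of the glued map that an oriented edge of the tree
becomes. -/
noncomputable def sideEquiv : T.Dart ≃ l.glued.submap.Dart :=
  Equiv.ofBijective (fun a => ⟨l.side a, a, rfl⟩)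
    ⟨fun _ _ h => l.side_injective (congrArg Subtype.val h), fun ⟨_, a, ha⟩ => ⟨a, Subtype.ext ha⟩⟩

theorem lift_incl_sideEquiv (a : T.Dart) :
    l.lift (l.glued.incl (l.sideEquiv a)) = B.rev (l.label (T.rev a)) := rfl

theorem sideEquiv_rev (a : T.Dart) :
    l.sideEquiv (T.rev a) = l.glued.submap.rev (l.sideEquiv a) :=
  Subtype.ext (l.gluedRevFun_side a).symm

theorem sideEquiv_root : l.sideEquiv T.root = l.glued.submap.root := rfl

theorem lift_rev {d : l.glued.Dart} (h : d ∉ l.glued.deco) :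
    l.lift (l.glued.rev d) = B.rev (l.lift d) := l.gluedRevFun_val h

theorem lift_faceStep (d : l.glued.Dart) : l.lift (l.glued.faceStep d) = B.faceStep (l.lift d) := by
  have h : l.glued.faceStep d = l.gluedFaceStep d :=
    congrArg l.gluedFaceStep (l.gluedRevFun_gluedRevFun d)
  rw [h]
  rfl

theorem lift_rot {d : l.glued.Dart} (h : d ∉ l.glued.deco) :
    l.lift (l.glued.rot d) = B.rot (l.lift d) := by
  rw [← faceStep_rev, lift_faceStep, lift_rev l h, faceStep_rev]

/-- Leaving a side of the tree by rotation enters the corner of `B` that starts with the boundary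
edge `l.label a`. -/
theorem lift_rot_incl_sideEquiv (a : T.Dart) :
    l.lift (l.glued.rot (l.glued.incl (l.sideEquiv a))) = B.rot (l.label a) := by
  rw [← faceStep_rev, lift_faceStep, ← incl_rev, ← sideEquiv_rev, lift_incl_sideEquiv, T.rev_rev,
    faceStep_rev]

/-- Rotating from the side of `a` to the next side, that of `c`, stays at one vertex of `B`. There
the boundary edge after the side of `c` is labelled by the predecessor of `c` in `T`. A simple
boundary visits the vertex once, so this predecessor is `a`. -/
theorem sideEquiv_rot (a : T.Dart) :
    l.sideEquiv (T.rot a) = l.glued.submap.rot (l.sideEquiv a) := by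
  obtain ⟨n, hn, hn'⟩ := submap_rot_spec (l.sideEquiv a)
  obtain ⟨c, hc⟩ := l.sideEquiv.surjective (l.glued.submap.rot (l.sideEquiv a))
  have hpow : ∀ k ≤ n, l.lift ((l.glued.rot ^ (k + 1)) (l.glued.incl (l.sideEquiv a))) =
      (B.rot ^ (k + 1)) (l.label a) := by
    intro k hk
    induction k with
    | zero => exact l.lift_rot_incl_sideEquiv a
    | succ k ih =>
      rw [pow_succ' _ (k + 1), pow_succ' _ (k + 1), Perm.mul_apply, Perm.mul_apply,
        lift_rot l (hn' k hk), ih (Nat.le_of_succ_le hk)]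
  have h1 := hpow n le_rfl
  rw [← hn, ← hc, lift_incl_sideEquiv] at h1
  have h2 : l.label (T.rot.symm c) = B.rot ((B.rot ^ (n + 1)) (l.label a)) := by
    rw [← h1, ← faceStep_apply, ← label_holeStep, holeStep_apply, T.rev_rev]
  have h3 : a = T.rot.symm c := l.eq_of_sameCycle _ _ (by
    rw [h2]
    exact (Perm.SameCycle.refl _ _).pow_right.apply_right)
  rw [← hc, h3, Equiv.apply_symm_apply]

theorem iso_submap_glued : T.Iso l.glued.submap :=
  ⟨l.sideEquiv, l.sideEquiv_rot, l.sideEquiv_rev, l.sideEquiv_root⟩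

theorem sideEquiv_holeStep (a : T.Dart) :
    l.sideEquiv (T.holeStep a) = l.glued.submap.holeStep (l.sideEquiv a) := by
  rw [holeStep_apply, holeStep_apply, Equiv.eq_symm_apply, ← sideEquiv_rot, Equiv.apply_symm_apply,
    sideEquiv_rev]

/-- Ungluing the glued map gives `B` back. -/
noncomputable def ungluedToFun : l.glued.unglued.Dart → B.Dart :=
  Sum.elim l.lift fun a => l.label (l.sideEquiv.symm a)

theorem ungluedToFun_old (d : l.glued.Dart) : l.ungluedToFun (l.glued.old d) = l.lift d := rfl

theorem ungluedToFun_new (a : T.Dart) :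
    l.ungluedToFun (l.glued.new (l.sideEquiv a)) = l.label a :=
  congrArg l.label (l.sideEquiv.symm_apply_apply a)

theorem old_or_new_sideEquiv (x : l.glued.unglued.Dart) :
    (∃ d, l.glued.old d = x) ∨ ∃ a, l.glued.new (l.sideEquiv a) = x := by
  obtain h | ⟨b, rfl⟩ := old_or_new x
  · exact Or.inl h
  · exact Or.inr ⟨l.sideEquiv.symm b, by rw [Equiv.apply_symm_apply]⟩

theorem ungluedToFun_bijective : Function.Bijective l.ungluedToFun := by
  constructor
  · intro x y h
    obtain ⟨d, rfl⟩ | ⟨a, rfl⟩ := l.old_or_new_sideEquiv x <;>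
      obtain ⟨d', rfl⟩ | ⟨b, rfl⟩ := l.old_or_new_sideEquiv y <;>
      simp only [ungluedToFun_old, ungluedToFun_new] at h
    · rw [l.lift_injective h]
    · exact absurd h.symm (l.label_ne_lift _ _)
    · exact absurd h (l.label_ne_lift _ _)
    · rw [l.injective h]
  · intro x
    obtain ⟨a, rfl⟩ | ⟨d, rfl⟩ := l.label_or_lift x
    · exact ⟨_, l.ungluedToFun_new a⟩
    · exact ⟨_, l.ungluedToFun_old d⟩

theorem ungluedToFun_rev (x : l.glued.unglued.Dart) :
    l.ungluedToFun (l.glued.unglued.rev x) = B.rev (l.ungluedToFun x) := by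
  obtain ⟨d, rfl⟩ | ⟨a, rfl⟩ := l.old_or_new_sideEquiv x
  · by_cases h : d ∈ l.glued.deco
    · obtain ⟨b, rfl⟩ := exists_incl_eq h
      obtain ⟨a, rfl⟩ := l.sideEquiv.surjective b
      rw [unglued_rev_old_incl, ← sideEquiv_rev, ungluedToFun_new, ungluedToFun_old,
        lift_incl_sideEquiv, B.rev_rev]
    · rw [unglued_rev_old h, ungluedToFun_old, ungluedToFun_old, lift_rev l h]
  · rw [unglued_rev_new, ← sideEquiv_rev, ungluedToFun_new, ungluedToFun_old, lift_incl_sideEquiv,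
      T.rev_rev]

theorem ungluedToFun_faceStep (x : l.glued.unglued.Dart) :
    l.ungluedToFun (l.glued.unglued.faceStep x) = B.faceStep (l.ungluedToFun x) := by
  obtain ⟨d, rfl⟩ | ⟨a, rfl⟩ := l.old_or_new_sideEquiv x
  · rw [unglued_faceStep_old, ungluedToFun_old, ungluedToFun_old, lift_faceStep]
  · rw [unglued_faceStep_new, ← sideEquiv_holeStep, ungluedToFun_new, ungluedToFun_new,
      label_holeStep]

theorem unglued_glued_iso : l.glued.unglued.Iso B := by
  refine ⟨Equiv.ofBijective _ l.ungluedToFun_bijective,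
    rot_eq_of_faceStep_eq l.ungluedToFun_rev l.ungluedToFun_faceStep, l.ungluedToFun_rev, ?_⟩
  rw [unglued_root, ← sideEquiv_root]
  exact (l.ungluedToFun_new _).trans l.label_root

end BoundaryLabelling

/-! ### The bijection and the correspondence of faces -/

theorem mainTheorem6 (q m : ℕ) :
    Set.BijOn ungluing (treeDecoratedAngulations q m)
        (planeTrees m ×ˢ angulationsWithSimpleBoundary q (2 * m)) ∧
      ∀ X : DecoratedRotationSystem, X.IsTreeDecoratedMap m →
        ∃ e : X.Face ≃ X.unglued.InternalFace,
          ∀ F : X.Face, X.unglued.faceDegree (e F).1 = X.faceDegree F := by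
  refine ⟨⟨?_, ?_, ?_⟩, fun X hX => ?_⟩
  · rintro _ ⟨X, hX, rfl⟩
    exact ⟨⟨X.submap, hX.2, rfl⟩,
      ⟨X.unglued, DecoratedRotationSystem.unglued_isAngulationWithSimpleBoundary hX, rfl⟩⟩
  · rintro _ ⟨X, hX, rfl⟩ _ ⟨Y, hY, rfl⟩ h
    exact Quotient.sound (DecoratedRotationSystem.iso_of_unglued_iso hX.2.2.1
      (Quotient.exact (congrArg Prod.fst h)) (Quotient.exact (congrArg Prod.snd h)))
  · rintro ⟨_, _⟩ ⟨⟨T, hT, rfl⟩, ⟨B, hB, rfl⟩⟩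
    obtain ⟨l⟩ := BoundaryLabelling.nonempty_of_simpleBoundary hT hB.1
    have h1 := l.iso_submap_glued
    have h2 := RootedRotationSystem.iso_equivalence.symm l.unglued_glued_iso
    -- Nothing is checked on the glued map directly: its decoration is isomorphic to `T` and its
    -- unglued map to `B`, and the Euler count carries planarity back.
    exact ⟨l.glued.toClass, ⟨l.glued,
      DecoratedRotationSystem.isTreeDecoratedAngulation_of_unglued (h1.isPlaneTree hT)
        (h2.isPlanarMap hB.1.1) (h2.internal_faceDegree hB.2), rfl⟩,
      Prod.ext (Quotient.sound (RootedRotationSystem.iso_equivalence.symm h1))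
        (Quotient.sound l.unglued_glued_iso)⟩
  · exact ⟨Equiv.ofBijective _ (DecoratedRotationSystem.toInternalFace_bijective hX.2.2.1),
      DecoratedRotationSystem.faceDegree_toInternalFace⟩
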